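/- Let $s\ge 2$ be an integer and let $X$ be a real random variable with c.d.f. $F$; for $0<p<1$ put $F^{\leftarrow}(p)=\inf\{t\in\mathbb R: F(t)\ge p\}$. Let $x=F^{\leftarrow}\left(\frac1{s+1}\right)$ and $y=F^{\leftarrow}\left(\frac s{s+1}\right)$, and assume that $y/x>0$ (i.e. $x$ and $y$ are non-zero and of the same sign, for instance $x>0$). Assume that the density $f=F'$ exists at $x$ and at $y$ with $0<f(x)<\infty$ and $0<f(y)<\infty$; $F$ need not be differentiable elsewhere. For each integer $k\ge 1$ let $n=(s+1)k-1$, and let $X_{(1,n)}\le\dots\le X_{(n,n)}$ be the increasing order statistics of $n$ independent observations on $X$. Put $$a=x f(x),\qquad b=y f(y),\qquad V=\frac1{(s+1)^2}\left(\frac s{a^2}-\frac2{ab}+\frac s{b^2}\right).$$ Then $V>0$ and, as $k\to\infty$, $$\sqrt{n}\left[\log\left(\frac{X_{(ks,n)}}{X_{(k,n)}}\right)-\log\left(\frac{F^{\leftarrow}\left(\frac s{s+1}\right)}{F^{\leftarrow}\left(\frac1{s+1}\right)}\right)\right]\ \xrightarrow{\ d\ }\ N(0,V),$$ where, on the event (of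 probability tending to $0$) that the ratio of order statistics is not positive or not defined, $\log z$ is read as $\log|z|$ for $z<0$ and as $0$ where the ratio is $0$ or has zero denominator. Moreover $p\mapsto\log|F^{\leftarrow}(p)|$ is differentiable at $\frac1{s+1}$ and at $\frac s{s+1}$, and $$a=\frac1{\left(\log|F^{\leftarrow}(p)|\right)'\big|_{p=1/(s+1)}},\qquad b=\frac1{\left(\log|F^{\leftarrow}(p)|\right)'\big|_{p=s/(s+1)}}$$ (the absolute values can be dropped if $x>0$). -/

import Mathlib

open MeasureTheory ProbabilityTheory Filter

/-- The generalized inverse `F^←(p) = inf {t : F(t) ≥ p}` of the c.d.f. `F` of the law `μ`,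
for `0 < p < 1`. -/
noncomputable def quantile (μ : Measure ℝ) (p : ℝ) : ℝ :=
  sInf {t : ℝ | p ≤ cdf μ t}

/-- The `j`-th smallest of the numbers `x 0, …, x (n - 1)`, counted with multiplicity, for
`1 ≤ j ≤ n`. The value `0` for other `j` is a mere convention. -/
noncomputable def orderStat {n : ℕ} (x : Fin n → ℝ) (j : ℕ) : ℝ :=
  if h : 1 ≤ j ∧ j ≤ n then x (Tuple.sort x ⟨j - 1, by omega⟩) else 0

/-- `V = (s / a² - 2 / (a b) + s / b²) / (s + 1)²`. -/
noncomputable def asympVariance (s : ℕ) (a b : ℝ) : ℝ :=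
  1 / ((s : ℝ) + 1) ^ 2 * ((s : ℝ) / a ^ 2 - 2 / (a * b) + (s : ℝ) / b ^ 2)

/-- `T_{k,s} = √n (log (X_(ks,n) / X_(k,n)) - log (y / x))` with `n = (s + 1) k - 1`,
as a function of the sample. -/
noncomputable def logRatioStat (s k : ℕ) (x y : ℝ) (v : Fin ((s + 1) * k - 1) → ℝ) : ℝ :=
  √(((s + 1) * k - 1 : ℕ) : ℝ) *
    (Real.log (orderStat v (k * s) / orderStat v k) - Real.log (y / x))

open scoped Topology ENNReal

/-! ### Quantiles -/

/-! A central order statistic is asymptotically linear in the empirical c.d.f. Write `S_t` for the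
centred count of observations `≤ t`, divided by `√n`. The event `X_(j,n) ≤ x + t/√n` says that at
least `j` observations are `≤ x + t/√n`. The count fluctuates by `S_x` up to `o_P(1)`, because the
increment of `S` over a shrinking interval has vanishing variance, and its mean moves by about `√n
f(x) t`. Hence `√n (X_(j,n) - x) = -S_x / f(x) + o_P(1)`
(`tendstoInMeasure_orderStat_sub_normalizedSum`); only differentiability of `F` at `x` enters.

The delta method for `log` at `x` and `y` turns the statistic into `S_x / a - S_y / b + o_P(1)`.
This is a single normalized i.i.d. sum, so the one-dimensional central limit theorem and Slutsky's
lemma suffice; the covariances `F(u)(1 - F(v))`, `u ≤ v`, give `V`.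

The derivative formulas for `a` and `b` come from differentiating the generalized inverse
(`hasDerivAt_quantile`). -/

theorem quantile_le_iff (μ : Measure ℝ) {p : ℝ} (hp0 : 0 < p) (hp1 : p < 1) (t : ℝ) :
    quantile μ p ≤ t ↔ p ≤ cdf μ t := by
  have hbdd : BddBelow {t : ℝ | p ≤ cdf μ t} := by
    obtain ⟨m, hm⟩ := ((tendsto_cdf_atBot μ).eventually_lt_const hp0).exists
    refine ⟨m, fun u hu => ?_⟩
    by_contra! h
    exact absurd (monotone_cdf μ h.le) (not_le.2 (lt_of_lt_of_le hm hu))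
  have hne : {t : ℝ | p ≤ cdf μ t}.Nonempty := by
    obtain ⟨m, hm⟩ := ((tendsto_cdf_atTop μ).eventually_const_lt hp1).exists
    exact ⟨m, hm.le⟩
  refine ⟨fun h => ?_, fun h => csInf_le hbdd h⟩
  refine le_trans ?_ (monotone_cdf μ h)
  -- Right continuity makes the infimum attained: `F ≥ p` at every point to its right.
  have hr : Tendsto (cdf μ) (𝓝[>] (quantile μ p)) (𝓝 (cdf μ (quantile μ p))) :=
    ((cdf μ).right_continuous (quantile μ p)).mono_left (nhdsWithin_mono _ Set.Ioi_subset_Ici_self)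
  refine ge_of_tendsto hr ?_
  filter_upwards [self_mem_nhdsWithin] with u hu
  obtain ⟨w, hw, hwu⟩ := exists_lt_of_csInf_lt hne hu
  exact le_trans hw (monotone_cdf μ hwu.le)

/-- To the left of the quantile `F < p`, so continuity there rules out a jump over `p`. -/
theorem cdf_quantile (μ : Measure ℝ) {p : ℝ} (hp0 : 0 < p) (hp1 : p < 1)
    (hc : ContinuousAt (cdf μ) (quantile μ p)) : cdf μ (quantile μ p) = p := by
  refine le_antisymm ?_ ((quantile_le_iff μ hp0 hp1 _).1 le_rfl)
  have hl : Tendsto (cdf μ) (𝓝[<] (quantile μ p)) (𝓝 (cdf μ (quantile μ p))) :=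
    hc.tendsto.mono_left nhdsWithin_le_nhds
  refine le_of_tendsto hl ?_
  filter_upwards [self_mem_nhdsWithin] with u hu
  by_contra! h
  exact absurd ((quantile_le_iff μ hp0 hp1 u).2 h.le) (not_le.2 hu)

theorem HasDerivAt.eventually_abs_sub_le {g : ℝ → ℝ} {d c : ℝ} (hg : HasDerivAt g d 0) (hc : 0 < c) :
    ∀ᶠ h in 𝓝 (0 : ℝ), |g h - g 0 - d * h| ≤ c * |h| := by
  have := (hasDerivAt_iff_isLittleO.1 hg).def hc
  filter_upwards [this] with h hh
  simpa [mul_comm d] using hh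

/-- The derivative of the quantile function is the reciprocal of the density. -/
theorem hasDerivAt_quantile (μ : Measure ℝ) {p : ℝ} (hp0 : 0 < p) (hp1 : p < 1) {d : ℝ}
    (hd : 0 < d) (hF : HasDerivAt (fun t => cdf μ t) d (quantile μ p)) :
    HasDerivAt (quantile μ) d⁻¹ p := by
  set x := quantile μ p with hx
  have hFx : cdf μ x = p := cdf_quantile μ hp0 hp1 hF.continuousAt
  -- By `quantile_le_iff`, the sign of this function at `h = q - p` tells whether `quantile μ q`
  -- lies above the line `x + c (q - p)`. The slopes `c = d⁻¹ ± ε` give derivatives `± ε d`, so the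
  -- quantile is squeezed between the two lines.
  have key : ∀ c : ℝ, HasDerivAt (fun h => cdf μ (x + c * h) - p - h) (c * d - 1) 0 := by
    intro c
    have h1 : HasDerivAt (fun h : ℝ => x + c * h) c 0 := by
      simpa using ((hasDerivAt_id (0 : ℝ)).const_mul c).const_add x
    have h2 : HasDerivAt (fun t => cdf μ t) d (x + c * 0) := by simpa using hF
    have h3 := ((h2.comp (0 : ℝ) h1).sub_const p).sub (hasDerivAt_id (0 : ℝ))
    simpa [mul_comm, Function.comp_def] using! h3
  rw [hasDerivAt_iff_isLittleO, Asymptotics.isLittleO_iff]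
  intro ε hε
  have hεd : 0 < ε * d := mul_pos hε hd
  have e1 := (key (d⁻¹ + ε)).eventually_abs_sub_le (half_pos hεd)
  have e2 := (key (d⁻¹ - ε)).eventually_abs_sub_le (half_pos hεd)
  have hsub : Tendsto (fun q : ℝ => q - p) (𝓝 p) (𝓝 0) := by
    have : Continuous fun q : ℝ => q - p := by fun_prop
    simpa using this.tendsto p
  filter_upwards [hsub.eventually e1, hsub.eventually e2, lt_mem_nhds hp0, gt_mem_nhds hp1]
    with q h1 h2 hq0 hq1
  have d1 : (d⁻¹ + ε) * d - 1 = ε * d := by field_simp; ring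
  have d2 : (d⁻¹ - ε) * d - 1 = -(ε * d) := by field_simp; ring
  simp only [d1, d2, mul_zero, add_zero, hFx, sub_self, sub_zero] at h1 h2
  rw [abs_le] at h1 h2
  rw [← hx, Real.norm_eq_abs, Real.norm_eq_abs, smul_eq_mul]
  have u1 := quantile_le_iff μ hq0 hq1 (x + (d⁻¹ + ε) * (q - p))
  have u2 := quantile_le_iff μ hq0 hq1 (x + (d⁻¹ - ε) * (q - p))
  rcases lt_trichotomy q p with hqp | hqp | hqp
  · rw [abs_of_neg (sub_neg.2 hqp)] at *
    have hneg : 0 < ε * d * (p - q) := mul_pos hεd (sub_pos.2 hqp)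
    have v1 : ¬ quantile μ q ≤ x + (d⁻¹ + ε) * (q - p) := by
      rw [u1]; linarith
    have v2 : quantile μ q ≤ x + (d⁻¹ - ε) * (q - p) := by
      rw [u2]; linarith
    rw [abs_le]; constructor <;> linarith
  · simp [hqp, hx]
  · rw [abs_of_pos (sub_pos.2 hqp)] at *
    have hpos : 0 < ε * d * (q - p) := mul_pos hεd (sub_pos.2 hqp)
    have v1 : quantile μ q ≤ x + (d⁻¹ + ε) * (q - p) := by
      rw [u1]; linarith
    have v2 : ¬ quantile μ q ≤ x + (d⁻¹ - ε) * (q - p) := by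
      rw [u2]; linarith
    rw [abs_le]; constructor <;> linarith

/-! ### Order statistics -/

/-- Sorting does not change the count of values `≤ t`, and in a sorted tuple these values form an
initial segment. This converts order statistics into sums of i.i.d. indicators. -/
theorem orderStat_le_iff {n : ℕ} (v : Fin n → ℝ) {j : ℕ} (h1 : 1 ≤ j) (hn : j ≤ n) (t : ℝ) :
    orderStat v j ≤ t ↔ (j : ℝ) ≤ ∑ i, (Set.Iic t).indicator (fun _ => (1 : ℝ)) (v i) := by
  classical
  have hcard : ∑ i, (Set.Iic t).indicator (fun _ => (1 : ℝ)) (v i) =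
      ((Finset.univ.filter fun i => (v ∘ Tuple.sort v) i ≤ t).card : ℝ) := by
    rw [← Equiv.sum_comp (Tuple.sort v)]
    simp [Set.indicator_apply, Finset.sum_boole]
  rw [hcard, Nat.cast_le, orderStat, dif_pos ⟨h1, hn⟩]
  have := Tuple.lt_card_le_iff_apply_le_of_monotone (a := t) (j := ⟨j - 1, by omega⟩)
    (Tuple.monotone_sort v)
  simp only [Function.comp_apply] at this ⊢
  rw [← this]
  omega

theorem measurable_orderStat (n j : ℕ) : Measurable fun v : Fin n → ℝ => orderStat v j := by
  by_cases h : 1 ≤ j ∧ j ≤ n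
  · refine measurable_of_Iic fun t => ?_
    have : (fun v : Fin n → ℝ => orderStat v j) ⁻¹' Set.Iic t =
        {v | (j : ℝ) ≤ ∑ i, (Set.Iic t).indicator (fun _ => (1 : ℝ)) (v i)} := by
      ext v
      exact orderStat_le_iff v h.1 h.2 t
    rw [this]
    refine measurableSet_le measurable_const (Finset.measurable_fun_sum _ fun i _ => ?_)
    exact (measurable_const.indicator measurableSet_Iic).comp (measurable_pi_apply i)
  · simp [orderStat, h]

theorem measurable_logRatioStat (s k : ℕ) (x y : ℝ) : Measurable (logRatioStat s k x y) := by
  unfold logRatioStat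
  have h1 := measurable_orderStat ((s + 1) * k - 1) (k * s)
  have h2 := measurable_orderStat ((s + 1) * k - 1) k
  fun_prop

/-! ### Stochastic boundedness and convergence in probability -/

/-- A family of real random variables is bounded in probability along a filter. -/
def BoundedInProb {ι Ω : Type*} [MeasurableSpace Ω] (P : Measure Ω) (W : ι → Ω → ℝ)
    (l : Filter ι) : Prop :=
  ∀ δ : ℝ≥0∞, 0 < δ → ∃ M : ℝ, 0 < M ∧ ∀ᶠ i in l, P {ω | M ≤ |W i ω|} ≤ δ

section InProbability

variable {ι Ω : Type*} [MeasurableSpace Ω] {P : Measure Ω} {l : Filter ι} {V W : ι → Ω → ℝ}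

theorem tendstoInMeasure_zero_iff :
    TendstoInMeasure P V l 0 ↔ ∀ ε, 0 < ε → Tendsto (fun i => P {ω | ε ≤ |V i ω|}) l (𝓝 0) := by
  simp [tendstoInMeasure_iff_norm]

theorem tendsto_measure_zero_of_subset_union {A B C : ι → Set Ω}
    (h : ∀ᶠ i in l, A i ⊆ B i ∪ C i) (hB : Tendsto (fun i => P (B i)) l (𝓝 0))
    (hC : Tendsto (fun i => P (C i)) l (𝓝 0)) : Tendsto (fun i => P (A i)) l (𝓝 0) := by
  have hBC := hB.add hC
  rw [add_zero] at hBC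
  refine tendsto_of_tendsto_of_tendsto_of_le_of_le' tendsto_const_nhds hBC
    (Eventually.of_forall fun _ => zero_le) ?_
  filter_upwards [h] with i hi
  exact (measure_mono hi).trans (measure_union_le _ _)

theorem TendstoInMeasure.add_zero_zero (hV : TendstoInMeasure P V l 0)
    (hW : TendstoInMeasure P W l 0) : TendstoInMeasure P (fun i ω => V i ω + W i ω) l 0 := by
  rw [tendstoInMeasure_zero_iff] at *
  intro ε hε
  refine tendsto_measure_zero_of_subset_union (Eventually.of_forall fun i ω hω => ?_)
    (hV _ (half_pos hε)) (hW _ (half_pos hε))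
  by_contra! h
  simp only [Set.mem_union, Set.mem_ofPred_eq, not_or, not_le] at h hω
  linarith [abs_add_le (V i ω) (W i ω)]

theorem TendstoInMeasure.const_mul_zero (hV : TendstoInMeasure P V l 0) (c : ℝ) :
    TendstoInMeasure P (fun i ω => c * V i ω) l 0 := by
  rw [tendstoInMeasure_zero_iff] at *
  intro ε hε
  have hc : 0 < |c| + 1 := by positivity
  refine tendsto_of_tendsto_of_tendsto_of_le_of_le tendsto_const_nhds
    (hV (ε / (|c| + 1)) (div_pos hε hc)) (fun _ => zero_le) fun i => measure_mono fun ω hω => ?_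
  simp only [Set.mem_ofPred_eq, abs_mul] at hω ⊢
  rw [div_le_iff₀ hc]
  nlinarith [abs_nonneg (V i ω), abs_nonneg c]

theorem BoundedInProb.of_tendstoInMeasure_sub (hW : BoundedInProb P W l)
    (h : TendstoInMeasure P (fun i ω => V i ω - W i ω) l 0) : BoundedInProb P V l := by
  rw [tendstoInMeasure_zero_iff] at h
  intro δ hδ
  obtain ⟨M, hM, hMW⟩ := hW (δ / 2) (ENNReal.half_pos hδ.ne')
  refine ⟨M + 1, by linarith, ?_⟩
  filter_upwards [hMW, (ENNReal.tendsto_nhds_zero.1 (h 1 one_pos)) _ (ENNReal.half_pos hδ.ne')]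
    with i h1 h2
  refine le_trans ((measure_mono ?_).trans (measure_union_le _ _))
    ((add_le_add h1 h2).trans_eq (ENNReal.add_halves δ))
  intro ω hω
  by_contra! h
  simp only [Set.mem_union, Set.mem_ofPred_eq, not_or, not_le] at h hω
  have := abs_add_le (W i ω) (V i ω - W i ω)
  rw [add_sub_cancel] at this
  linarith

theorem BoundedInProb.tendsto_measure_ge {A : ι → Ω → ℝ} {r : ι → ℝ} {x : ℝ}
    (hA : BoundedInProb P (fun i ω => r i * (A i ω - x)) l) (hr : Tendsto r l atTop) {η : ℝ}
    (hη : 0 < η) : Tendsto (fun i => P {ω | η ≤ |A i ω - x|}) l (𝓝 0) := by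
  rw [ENNReal.tendsto_nhds_zero]
  intro δ hδ
  obtain ⟨M, hM, hMA⟩ := hA δ hδ
  filter_upwards [hMA, hr.eventually_ge_atTop (M / η)] with i h1 h2
  refine (measure_mono fun ω hω => ?_).trans h1
  simp only [Set.mem_ofPred_eq] at hω ⊢
  have hr0 : 0 < r i := lt_of_lt_of_le (by positivity) h2
  rw [abs_mul, abs_of_pos hr0]
  calc M = M / η * η := by field_simp
    _ ≤ r i * |A i ω - x| := by gcongr

/-- The **delta method**, as a linearization in probability. -/
theorem BoundedInProb.delta_method {A : ι → Ω → ℝ} {r : ι → ℝ} {x d : ℝ} {g : ℝ → ℝ}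
    (hA : BoundedInProb P (fun i ω => r i * (A i ω - x)) l) (hr : Tendsto r l atTop)
    (hg : HasDerivAt g d x) :
    TendstoInMeasure P (fun i ω => r i * (g (A i ω) - g x) - d * (r i * (A i ω - x))) l 0 := by
  rw [tendstoInMeasure_zero_iff]
  intro ε hε
  rw [ENNReal.tendsto_nhds_zero]
  intro δ hδ
  obtain ⟨M, hM, hMA⟩ := hA (δ / 2) (ENNReal.half_pos hδ.ne')
  -- With slope error `ε / M`, the scaled remainder stays below `ε` wherever the scaled deviation is
  -- below `M`.
  have hlin := (hasDerivAt_iff_isLittleO.1 hg).def (div_pos hε hM)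
  obtain ⟨η, hη, hηx⟩ := Metric.eventually_nhds_iff.1 hlin
  have hclose := ENNReal.tendsto_nhds_zero.1 (hA.tendsto_measure_ge hr hη) _
    (ENNReal.half_pos hδ.ne')
  filter_upwards [hMA, hclose, hr.eventually_gt_atTop 0] with i h1 h2 hri
  refine le_trans ((measure_mono ?_).trans (measure_union_le _ _))
    ((add_le_add h1 h2).trans_eq (ENNReal.add_halves δ))
  intro ω hω
  by_contra! h
  simp only [Set.mem_union, Set.mem_ofPred_eq, not_or, not_le] at h hω
  have h3 := hηx (y := A i ω) (by simpa [Real.dist_eq] using h.2)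
  simp only [Real.norm_eq_abs, smul_eq_mul] at h3
  have h4 : |r i * (g (A i ω) - g x) - d * (r i * (A i ω - x))| =
      r i * |g (A i ω) - g x - (A i ω - x) * d| := by
    rw [← abs_of_pos hri, ← abs_mul, abs_of_pos hri]
    congr 1
    ring
  have h5 : r i * |g (A i ω) - g x - (A i ω - x) * d| ≤ ε / M * |r i * (A i ω - x)| := by
    rw [abs_mul, abs_of_pos hri]
    calc _ ≤ r i * (ε / M * |A i ω - x|) := by gcongr
      _ = _ := by ring
  have h6 : ε / M * |r i * (A i ω - x)| < ε := by
    calc _ < ε / M * M := by gcongr; exact h.1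
      _ = ε := by field_simp
  linarith

/-- If a family is bounded in probability and another one lies, at each fixed level, asymptotically
on the same side, then the two families are asymptotically equal in probability. -/
theorem tendstoInMeasure_sub_of_levels (hW : BoundedInProb P W l)
    (h1 : ∀ t ε : ℝ, 0 < ε → Tendsto (fun i => P {ω | V i ω ≤ t ∧ t + ε ≤ W i ω}) l (𝓝 0))
    (h2 : ∀ t ε : ℝ, 0 < ε → Tendsto (fun i => P {ω | t < V i ω ∧ W i ω ≤ t - ε}) l (𝓝 0)) :
    TendstoInMeasure P (fun i ω => V i ω - W i ω) l 0 := by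
  rw [tendstoInMeasure_zero_iff]
  intro ε' hε'
  obtain ⟨ε, hε, rfl⟩ : ∃ ε, 0 < ε ∧ ε' = 3 * ε := ⟨ε' / 3, by linarith, by ring⟩
  rw [ENNReal.tendsto_nhds_zero]
  intro δ hδ
  obtain ⟨M, hM, hMW⟩ := hW (δ / 2) (ENNReal.half_pos hδ.ne')
  -- Finitely many grid levels `ε j` suffice: if `|W| < M` and `m = ⌊W / ε⌋`, the separating level
  -- is `m + 2` or `m - 1`, and the margin `2` keeps both in `[-K, K]`.
  set K : ℤ := ⌈M / ε⌉ + 2 with hK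
  set B : ι → Set Ω := fun i => ⋃ j ∈ Finset.Icc (-K) K,
    ({ω | V i ω ≤ ε * j ∧ ε * j + ε ≤ W i ω} ∪ {ω | ε * j < V i ω ∧ W i ω ≤ ε * j - ε}) with hB
  have hBlim : Tendsto (fun i => P (B i)) l (𝓝 0) := by
    have hsum : Tendsto (fun i => ∑ j ∈ Finset.Icc (-K) K,
        (P {ω | V i ω ≤ ε * j ∧ ε * j + ε ≤ W i ω} + P {ω | ε * j < V i ω ∧ W i ω ≤ ε * j - ε}))
        l (𝓝 0) := by
      have := tendsto_finsetSum (Finset.Icc (-K) K)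
        fun (j : ℤ) _ => (h1 (ε * j) ε hε).add (h2 (ε * j) ε hε)
      simpa using this
    refine tendsto_of_tendsto_of_tendsto_of_le_of_le tendsto_const_nhds hsum
      (fun _ => zero_le) fun i => ?_
    exact (measure_biUnion_finset_le _ _).trans
      (Finset.sum_le_sum fun j _ => measure_union_le _ _)
  filter_upwards [hMW, ENNReal.tendsto_nhds_zero.1 hBlim _ (ENNReal.half_pos hδ.ne')] with i e1 e2
  refine le_trans ((measure_mono ?_).trans (measure_union_le _ _))
    ((add_le_add e1 e2).trans_eq (ENNReal.add_halves δ))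
  intro ω hω
  by_cases hωM : M ≤ |W i ω|
  · exact Or.inl hωM
  right
  rw [not_le, abs_lt] at hωM
  simp only [Set.mem_ofPred_eq] at hω
  have hMK : M ≤ ε * (K - 2) := by
    have := Int.le_ceil (M / ε)
    rw [div_le_iff₀ hε] at this
    rw [hK]; push_cast; linarith
  have hfl := Int.floor_le (W i ω / ε)
  have hfl' := Int.lt_floor_add_one (W i ω / ε)
  rw [le_div_iff₀ hε] at hfl
  rw [div_lt_iff₀ hε] at hfl'
  simp only [hB, Set.mem_iUnion, Finset.mem_Icc, Set.mem_union, Set.mem_ofPred_eq]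
  have hb1 : ((⌊W i ω / ε⌋ : ℤ) : ℝ) < K - 2 := by nlinarith
  have hb2 : (-(K : ℝ) + 1) < ((⌊W i ω / ε⌋ : ℤ) : ℝ) := by nlinarith
  have hb1' : ⌊W i ω / ε⌋ < K - 2 := by exact_mod_cast hb1
  have hb2' : -K + 1 < ⌊W i ω / ε⌋ := by exact_mod_cast hb2
  rcases le_abs.1 hω with h | h
  · refine ⟨⌊W i ω / ε⌋ + 2, ⟨by omega, by omega⟩, Or.inr ⟨?_, ?_⟩⟩ <;> push_cast <;> linarith
  · refine ⟨⌊W i ω / ε⌋ - 1, ⟨by omega, by omega⟩, Or.inl ⟨?_, ?_⟩⟩ <;> push_cast <;> linarith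

end InProbability

/-! ### Normalized sums of independent, identically distributed variables -/

/-- The centred sum of `g (Y 0), …, g (Y (n - 1))`, divided by `√n`, where the `Y i` have law `μ`. -/
noncomputable def normalizedSum {Ω : Type*} (μ : Measure ℝ) (Y : ℕ → Ω → ℝ) (g : ℝ → ℝ) (n : ℕ)
    (ω : Ω) : ℝ :=
  (√(n : ℝ))⁻¹ * (∑ i ∈ Finset.range n, g (Y i ω) - n * ∫ z, g z ∂μ)

/-- The indicator function of `(-∞, t]`. -/
noncomputable def iicInd (t : ℝ) : ℝ → ℝ := (Set.Iic t).indicator fun _ => 1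

theorem measurable_iicInd (t : ℝ) : Measurable (iicInd t) :=
  measurable_const.indicator measurableSet_Iic

theorem iicInd_mul_of_le {s t : ℝ} (h : s ≤ t) (z : ℝ) : iicInd s z * iicInd t z = iicInd s z := by
  by_cases hz : z ≤ s
  · simp [iicInd, hz, hz.trans h]
  · simp [iicInd, hz]

theorem abs_iicInd_le (t z : ℝ) : |iicInd t z| ≤ 1 := by
  by_cases hz : z ≤ t <;> simp [iicInd, hz]

theorem normalizedSum_comb {Ω : Type*} {μ : Measure ℝ} {Y : ℕ → Ω → ℝ} {g h : ℝ → ℝ}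
    (hg : Integrable g μ) (hh : Integrable h μ) (c d : ℝ)
    (n : ℕ) (ω : Ω) :
    normalizedSum μ Y (fun z => c * g z - d * h z) n ω =
      c * normalizedSum μ Y g n ω - d * normalizedSum μ Y h n ω := by
  simp only [normalizedSum]
  rw [integral_sub (hg.const_mul c) (hh.const_mul d), integral_const_mul, integral_const_mul,
    Finset.sum_sub_distrib, ← Finset.mul_sum, ← Finset.mul_sum]
  ring

section Iid

variable {μ : Measure ℝ} {Ω : Type*} [MeasurableSpace Ω] {P : Measure Ω}
  [IsProbabilityMeasure P] {Y : ℕ → Ω → ℝ}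

/-- **Chebyshev's inequality** for normalized sums. -/
theorem measure_normalizedSum_ge_le (hlaw : ∀ i, HasLaw (Y i) μ P) (hindep : iIndepFun Y P)
    {g : ℝ → ℝ} (hgm : Measurable g) (hg : MemLp g 2 μ) (n : ℕ) {c : ℝ} (hc : 0 < c) :
    P {ω | c ≤ |normalizedSum μ Y g n ω|} ≤ ENNReal.ofReal (Var[g; μ] / c ^ 2) := by
  rcases Nat.eq_zero_or_pos n with rfl | hn
  · simp [normalizedSum, hc.not_ge]
  have hn' : (0 : ℝ) < n := by exact_mod_cast hn
  have hmem : ∀ i, MemLp (fun ω => g (Y i ω)) 2 P := fun i => by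
    have := hg
    rw [← (hlaw i).map_eq] at this
    exact (memLp_map_measure_iff this.1 (hlaw i).aemeasurable).1 this
  have hint : ∀ i, ∫ ω, g (Y i ω) ∂P = ∫ z, g z ∂μ := fun i => by
    rw [← (hlaw i).map_eq, integral_map (hlaw i).aemeasurable hgm.aestronglyMeasurable]
  have hvar : ∀ i, Var[fun ω => g (Y i ω); P] = Var[g; μ] := fun i => by
    rw [← (hlaw i).map_eq, variance_map hgm.aemeasurable (hlaw i).aemeasurable]
    rfl
  have hS : MemLp (∑ i ∈ Finset.range n, fun ω => g (Y i ω)) 2 P :=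
    memLp_finsetSum' _ fun i _ => hmem i
  have hVS : Var[∑ i ∈ Finset.range n, fun ω => g (Y i ω); P] = n * Var[g; μ] := by
    rw [IndepFun.variance_sum (fun i _ => hmem i)]
    · simp [hvar]
    · intro i _ j _ hij
      exact (hindep.indepFun hij).comp hgm hgm
  have hES : ∫ ω, (∑ i ∈ Finset.range n, fun ω => g (Y i ω)) ω ∂P = n * ∫ z, g z ∂μ := by
    simp only [Finset.sum_apply]
    rw [integral_finsetSum _ fun i _ => (hmem i).integrable (by norm_num)]
    simp [hint]
  have hsq : 0 < √(n : ℝ) := Real.sqrt_pos.2 hn'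
  have hch := meas_ge_le_variance_div_sq hS (mul_pos hc hsq)
  rw [hVS, hES] at hch
  refine (measure_mono fun ω hω => ?_).trans (hch.trans_eq ?_)
  · simp only [Set.mem_ofPred_eq, normalizedSum, abs_mul, abs_inv, abs_of_pos hsq] at hω ⊢
    rw [Finset.sum_apply]
    rw [inv_mul_eq_div, le_div_iff₀ hsq] at hω
    exact hω
  · rw [mul_pow, Real.sq_sqrt hn'.le]
    congr 1
    field_simp

theorem boundedInProb_normalizedSum {ι : Type*} {l : Filter ι} (hlaw : ∀ i, HasLaw (Y i) μ P)
    (hindep : iIndepFun Y P) {g : ℝ → ℝ} (hgm : Measurable g) (hg : MemLp g 2 μ) (N : ι → ℕ) :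
    BoundedInProb P (fun i ω => normalizedSum μ Y g (N i) ω) l := by
  intro δ hδ
  have hlim : Tendsto (fun c : ℝ => ENNReal.ofReal (Var[g; μ] / c ^ 2)) atTop (𝓝 0) := by
    rw [← ENNReal.ofReal_zero]
    exact ENNReal.tendsto_ofReal (tendsto_const_nhds.div_atTop (tendsto_pow_atTop two_ne_zero))
  obtain ⟨M, h1, h2⟩ := ((ENNReal.tendsto_nhds_zero.1 hlim δ hδ).and (eventually_gt_atTop 0)).exists
  exact ⟨M, h2, Eventually.of_forall fun i =>
    (measure_normalizedSum_ge_le hlaw hindep hgm hg (N i) h2).trans h1⟩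

/-- The **central limit theorem** for normalized sums along a sequence of sample sizes. -/
theorem tendstoInDistribution_normalizedSum (hlaw : ∀ i, HasLaw (Y i) μ P)
    (hindep : iIndepFun Y P) {g : ℝ → ℝ} (hgm : Measurable g) (hg : MemLp g 2 μ) {N : ℕ → ℕ}
    (hN : Tendsto N atTop atTop) :
    TendstoInDistribution (fun k ω => normalizedSum μ Y g (N k) ω) atTop (id : ℝ → ℝ)
      (fun _ => P) (gaussianReal 0 Var[g; μ].toNNReal) := by
  have hident : ∀ i, IdentDistrib (fun ω => g (Y i ω)) (fun ω => g (Y 0 ω)) P P := fun i =>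
    ((hlaw i).identDistrib (hlaw 0)).comp hgm
  have hmem : MemLp (fun ω => g (Y 0 ω)) 2 P := by
    have := hg
    rw [← (hlaw 0).map_eq] at this
    exact (memLp_map_measure_iff this.1 (hlaw 0).aemeasurable).1 this
  have hint : ∫ ω, g (Y 0 ω) ∂P = ∫ z, g z ∂μ := by
    rw [← (hlaw 0).map_eq, integral_map (hlaw 0).aemeasurable hgm.aestronglyMeasurable]
  have hvar : Var[fun ω => g (Y 0 ω); P] = Var[g; μ] := by
    rw [← (hlaw 0).map_eq, variance_map hgm.aemeasurable (hlaw 0).aemeasurable]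
    rfl
  have hclt := tendstoInDistribution_inv_sqrt_mul_sum_sub (P := P)
    (X := fun i ω => g (Y i ω)) (Y := (id : ℝ → ℝ)) (P' := gaussianReal 0 Var[g; μ].toNNReal)
    (by rw [hvar]; exact HasLaw.id) hmem (hindep.comp (fun _ => g) fun _ => hgm) hident
  rw [hint] at hclt
  exact ⟨fun k => hclt.forall_aemeasurable (N k), hclt.aemeasurable_limit, hclt.tendsto.comp hN⟩

variable [IsProbabilityMeasure μ]

theorem memLp_iicInd (t : ℝ) (p : ℝ≥0∞) : MemLp (iicInd t) p μ :=
  MemLp.of_bound (measurable_iicInd t).aestronglyMeasurable 1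
    (Eventually.of_forall fun z => abs_iicInd_le t z)

theorem integrable_iicInd (t : ℝ) : Integrable (iicInd t) μ :=
  memLp_one_iff_integrable.1 (memLp_iicInd t 1)

theorem integral_iicInd (t : ℝ) : ∫ z, iicInd t z ∂μ = cdf μ t := by
  rw [cdf_eq_real, iicInd, integral_indicator measurableSet_Iic]
  simp

/-- Up to sign the difference is the indicator of the interval between `s` and `t`, whose second
moment is its mass. The factors `1` match the form of `normalizedSum_comb`. -/
theorem variance_iicInd_sub_le (s t : ℝ) :
    Var[fun z => 1 * iicInd s z - 1 * iicInd t z; μ] ≤ |cdf μ s - cdf μ t| := by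
  have hm : Measurable fun z => 1 * iicInd s z - 1 * iicInd t z :=
    ((measurable_iicInd s).const_mul 1).sub ((measurable_iicInd t).const_mul 1)
  refine (variance_le_expectation_sq hm.aestronglyMeasurable).trans ?_
  have aux : ∀ u v : ℝ, u ≤ v →
      ∫ z, (iicInd u z - iicInd v z) ^ 2 ∂μ = cdf μ v - cdf μ u := by
    intro u v huv
    rw [← integral_iicInd u, ← integral_iicInd v,
      ← integral_sub (integrable_iicInd v) (integrable_iicInd u)]
    congr 1
    ext z
    have h1 := iicInd_mul_of_le huv z
    have h2 := iicInd_mul_of_le (le_refl u) z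
    have h3 := iicInd_mul_of_le (le_refl v) z
    linear_combination h2 + h3 - 2 * h1
  simp only [Pi.pow_apply, one_mul]
  rcases le_total s t with h | h
  · rw [aux s t h, abs_sub_comm]
    exact le_abs_self _
  · have : ∀ z, (iicInd s z - iicInd t z) ^ 2 = (iicInd t z - iicInd s z) ^ 2 := fun z => by ring
    simp_rw [this]
    rw [aux t s h]
    exact le_abs_self _

/-- Increments of the empirical process over shrinking intervals vanish in probability. -/
theorem tendsto_measure_normalizedSum_increment {ι : Type*} {l : Filter ι}
    (hlaw : ∀ i, HasLaw (Y i) μ P) (hindep : iIndepFun Y P) (N : ι → ℕ) {u : ι → ℝ} {x : ℝ}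
    (hu : Tendsto (fun i => cdf μ (u i)) l (𝓝 (cdf μ x))) {c : ℝ} (hc : 0 < c) :
    Tendsto (fun i => P {ω | c ≤ |normalizedSum μ Y (iicInd (u i)) (N i) ω -
      normalizedSum μ Y (iicInd x) (N i) ω|}) l (𝓝 0) := by
  have hlim : Tendsto (fun i => ENNReal.ofReal (|cdf μ (u i) - cdf μ x| / c ^ 2)) l (𝓝 0) := by
    rw [← ENNReal.ofReal_zero]
    refine ENNReal.tendsto_ofReal ?_
    have := ((hu.sub_const (cdf μ x)).abs).div_const (c ^ 2)
    simpa using this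
  refine tendsto_of_tendsto_of_tendsto_of_le_of_le tendsto_const_nhds hlim
    (fun _ => zero_le) fun i => ?_
  have hm : Measurable fun z => 1 * iicInd (u i) z - 1 * iicInd x z :=
    ((measurable_iicInd _).const_mul 1).sub ((measurable_iicInd x).const_mul 1)
  have hL : MemLp (fun z => 1 * iicInd (u i) z - 1 * iicInd x z) 2 μ :=
    ((memLp_iicInd _ 2).const_mul 1).sub ((memLp_iicInd x 2).const_mul 1)
  have h := measure_normalizedSum_ge_le hlaw hindep hm hL (N i) hc
  have e := fun ω => normalizedSum_comb (Y := Y) (integrable_iicInd (μ := μ) (u i))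
    (integrable_iicInd (μ := μ) x) 1 1 (N i) ω
  simp only [e] at h
  simp only [one_mul (normalizedSum _ _ _ _ _)] at h
  refine h.trans (ENNReal.ofReal_le_ofReal ?_)
  gcongr
  exact variance_iicInd_sub_le (u i) x

/-- The **Bahadur–Ghosh representation** of sample quantiles. -/
theorem tendstoInMeasure_orderStat_sub_normalizedSum {ι : Type*} {l : Filter ι}
    (hlaw : ∀ i, HasLaw (Y i) μ P) (hindep : iIndepFun Y P) {N j : ι → ℕ}
    (hN : Tendsto N l atTop) (hj : ∀ᶠ i in l, 1 ≤ j i ∧ j i ≤ N i) {x d : ℝ} (hd : 0 < d)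
    (hF : HasDerivAt (fun t => cdf μ t) d x)
    (hr : Tendsto (fun i => ((j i : ℝ) - N i * cdf μ x) / √(N i : ℝ)) l (𝓝 0)) :
    TendstoInMeasure P (fun i ω =>
      √(N i : ℝ) * (orderStat (fun m : Fin (N i) => Y m ω) (j i) - x) -
        -d⁻¹ * normalizedSum μ Y (iicInd x) (N i) ω) l 0 := by
  have hsq : Tendsto (fun i => √(N i : ℝ)) l atTop :=
    Real.tendsto_sqrt_atTop.comp (tendsto_natCast_atTop_atTop.comp hN)
  have hbd : BoundedInProb P
      (fun i ω => -d⁻¹ * normalizedSum μ Y (iicInd x) (N i) ω) l := by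
    have h := boundedInProb_normalizedSum (l := l) hlaw hindep
      ((measurable_iicInd x).const_mul (-d⁻¹)) ((memLp_iicInd x 2).const_mul (-d⁻¹)) N
    have e := fun n ω => normalizedSum_comb (Y := Y) (integrable_iicInd (μ := μ) x)
      (integrable_iicInd (μ := μ) x) (-d⁻¹) 0 n ω
    simp only [zero_mul, sub_zero] at e
    simpa only [e] using h
  -- the level `x + t / √N`, its probability and the sides of the order statistic
  have hu : ∀ t : ℝ, Tendsto (fun i => x + t / √(N i : ℝ)) l (𝓝 x) := fun t => by
    simpa using (tendsto_const_nhds (x := x)).add ((tendsto_const_nhds (x := t)).div_atTop hsq)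
  have hcdf : ∀ t : ℝ, Tendsto (fun i => cdf μ (x + t / √(N i : ℝ))) l (𝓝 (cdf μ x)) :=
    fun t => hF.continuousAt.tendsto.comp (hu t)
  have hslope : ∀ t : ℝ, Tendsto
      (fun i => √(N i : ℝ) * (cdf μ (x + t / √(N i : ℝ)) - cdf μ x) - d * t) l (𝓝 0) := by
    -- Difference quotient of `h ↦ F(x + t h)` at `0`, taken along `h = 1 / √N`.
    intro t
    have hinv : HasDerivAt (fun h : ℝ => cdf μ (x + t * h)) (d * t) 0 := by
      have h1 : HasDerivAt (fun h : ℝ => x + t * h) t 0 := by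
        simpa using ((hasDerivAt_id (0 : ℝ)).const_mul t).const_add x
      have h2 : HasDerivAt (fun t => cdf μ t) d (x + t * 0) := by simpa using hF
      exact h2.comp (0 : ℝ) h1
    have h3 := hinv.tendsto_slope_zero
    have h4 : Tendsto (fun i => (√(N i : ℝ))⁻¹) l (𝓝[≠] 0) := by
      refine tendsto_nhdsWithin_iff.2 ⟨tendsto_inv_atTop_zero.comp hsq, ?_⟩
      filter_upwards [hsq.eventually_gt_atTop 0] with i hi
      simp [hi.ne']
    have h5 := (h3.comp h4).sub_const (d * t)
    simpa [Function.comp_def, div_eq_mul_inv] using h5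
  have hside : ∀ t : ℝ, ∀ᶠ i in l, ∀ ω,
      (√(N i : ℝ) * (orderStat (fun m : Fin (N i) => Y m ω) (j i) - x) ≤ t ↔
        ((j i : ℝ) - N i * cdf μ x) / √(N i : ℝ) ≤
          normalizedSum μ Y (iicInd (x + t / √(N i : ℝ))) (N i) ω +
            √(N i : ℝ) * (cdf μ (x + t / √(N i : ℝ)) - cdf μ x)) := by
    intro t
    filter_upwards [hj, hsq.eventually_gt_atTop 0] with i hi hpos ω
    have hN0 : (√(N i : ℝ)) * √(N i : ℝ) = N i := Real.mul_self_sqrt (Nat.cast_nonneg _)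
    have e1 : √(N i : ℝ) * (orderStat (fun m : Fin (N i) => Y m ω) (j i) - x) ≤ t ↔
        orderStat (fun m : Fin (N i) => Y m ω) (j i) ≤ x + t / √(N i : ℝ) := by
      rw [← le_div_iff₀' hpos, sub_le_iff_le_add']
    rw [e1, orderStat_le_iff _ hi.1 hi.2,
      Fin.sum_univ_eq_sum_range (fun m => (Set.Iic (x + t / √(N i : ℝ))).indicator
        (fun _ => (1 : ℝ)) (Y m ω)), div_le_iff₀ hpos, normalizedSum, integral_iicInd]
    have e2 : ((√(N i : ℝ))⁻¹ * (∑ m ∈ Finset.range (N i), iicInd (x + t / √(N i : ℝ)) (Y m ω) -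
        N i * cdf μ (x + t / √(N i : ℝ))) +
        √(N i : ℝ) * (cdf μ (x + t / √(N i : ℝ)) - cdf μ x)) * √(N i : ℝ) =
        ∑ m ∈ Finset.range (N i), iicInd (x + t / √(N i : ℝ)) (Y m ω) - N i * cdf μ x := by
      have hne := hpos.ne'
      have e3 : (√(N i : ℝ))⁻¹ * √(N i : ℝ) = 1 := inv_mul_cancel₀ hne
      linear_combination (∑ m ∈ Finset.range (N i), iicInd (x + t / √(N i : ℝ)) (Y m ω) -
        N i * cdf μ (x + t / √(N i : ℝ))) * e3 +
        (cdf μ (x + t / √(N i : ℝ)) - cdf μ x) * hN0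
    rw [e2, sub_le_sub_iff_right]
    rfl
  refine tendstoInMeasure_sub_of_levels hbd (fun t ε hε => ?_) (fun t ε hε => ?_)
  all_goals
    -- On either bad event the increment of the normalized sum from `x` to `x + t / √N` would be at
    -- least `d ε` in absolute value, up to the slope and rounding errors. These total less than `d
    -- ε / 2`, so `d ε / 2` remains.
    have hdε : 0 < d * ε / 2 := by positivity
    refine tendsto_of_tendsto_of_tendsto_of_le_of_le' tendsto_const_nhds
      (tendsto_measure_normalizedSum_increment hlaw hindep N (hcdf t) hdε)
      (Eventually.of_forall fun _ => zero_le) ?_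
    have hsmall := (hslope t).sub hr
    rw [sub_zero] at hsmall
    filter_upwards [hside t, (Metric.tendsto_nhds.1 hsmall) _ hdε] with i h1 h2
    refine measure_mono fun ω hω => ?_
    obtain ⟨hV, hW⟩ := hω
    rw [Real.dist_eq, sub_zero, abs_lt] at h2
    simp only [Set.mem_ofPred_eq]
    set S := normalizedSum μ Y (iicInd x) (N i) ω
  · have hV' := (h1 ω).1 hV
    have hW' : d * (t + ε) ≤ -S := by
      calc d * (t + ε) ≤ d * (-d⁻¹ * S) := by gcongr
        _ = -S := by field_simp
    refine le_trans ?_ (le_abs_self _)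
    linarith
  · have hV' := not_le.1 (mt (h1 ω).2 (not_le.2 hV))
    have hW' : -S ≤ d * (t - ε) := by
      calc -S = d * (-d⁻¹ * S) := by field_simp
        _ ≤ d * (t - ε) := by gcongr
    refine le_trans ?_ (neg_le_abs _)
    linarith

/-- For `s ≤ t` the product of the two indicators is the first one, so their covariance is `F(s)(1 -
F(t))`. -/
theorem variance_iicInd_comb {s t : ℝ} (hst : s ≤ t) (c d : ℝ) :
    Var[fun z => c * iicInd s z - d * iicInd t z; μ] =
      c ^ 2 * (cdf μ s * (1 - cdf μ s)) - 2 * c * d * (cdf μ s * (1 - cdf μ t)) +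
        d ^ 2 * (cdf μ t * (1 - cdf μ t)) := by
  have hs := integrable_iicInd (μ := μ) s
  have ht := integrable_iicInd (μ := μ) t
  have hL : MemLp (fun z => c * iicInd s z - d * iicInd t z) 2 μ :=
    ((memLp_iicInd s 2).const_mul c).sub ((memLp_iicInd t 2).const_mul d)
  have hsq : (fun z => (c * iicInd s z - d * iicInd t z) ^ 2) =
      fun z => (c ^ 2 - 2 * c * d) * iicInd s z + d ^ 2 * iicInd t z := by
    ext z
    linear_combination c ^ 2 * iicInd_mul_of_le (le_refl s) z +
      d ^ 2 * iicInd_mul_of_le (le_refl t) z - 2 * c * d * iicInd_mul_of_le hst z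
  rw [variance_eq_sub hL]
  simp only [Pi.pow_apply]
  rw [hsq, integral_add (hs.const_mul _) (ht.const_mul _),
    integral_sub (hs.const_mul _) (ht.const_mul _)]
  simp only [integral_const_mul, integral_iicInd]
  ring

end Iid

/-! ### The log-ratio statistic -/

theorem asympVariance_pos {s : ℕ} (hs : 2 ≤ s) {a b : ℝ} (ha : a ≠ 0) :
    0 < asympVariance s a b := by
  have hs' : (2 : ℝ) ≤ s := by exact_mod_cast hs
  -- Completing the square leaves the coefficient `s - 1`, positive since `s ≥ 2`.
  have h1 : (s : ℝ) / a ^ 2 - 2 / (a * b) + (s : ℝ) / b ^ 2 =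
      (a⁻¹ - b⁻¹) ^ 2 + (s - 1) * (a⁻¹ ^ 2 + b⁻¹ ^ 2) := by
    simp only [div_eq_mul_inv, mul_inv, ← inv_pow]
    ring
  have h2 : 0 < a⁻¹ ^ 2 := by positivity
  have h3 : 0 < (s - 1 : ℝ) * (a⁻¹ ^ 2 + b⁻¹ ^ 2) := mul_pos (by linarith) (by positivity)
  unfold asympVariance
  rw [h1]
  have h4 := sq_nonneg (a⁻¹ - b⁻¹)
  have h5 : (0 : ℝ) < 1 / ((s : ℝ) + 1) ^ 2 := by positivity
  exact mul_pos h5 (by linarith)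

/-- Convergence in distribution only depends on the laws of the variables. -/
theorem TendstoInDistribution.of_map_eq {ι E Ω' : Type*} {Ω₁ Ω₂ : ι → Type*}
    [∀ i, MeasurableSpace (Ω₁ i)] [∀ i, MeasurableSpace (Ω₂ i)] [MeasurableSpace Ω']
    [TopologicalSpace E] [MeasurableSpace E] [OpensMeasurableSpace E]
    {P₁ : ∀ i, Measure (Ω₁ i)} {P₂ : ∀ i, Measure (Ω₂ i)} [∀ i, IsProbabilityMeasure (P₁ i)]
    [∀ i, IsProbabilityMeasure (P₂ i)] {P' : Measure Ω'} [IsProbabilityMeasure P'] {l : Filter ι}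
    {X₁ : ∀ i, Ω₁ i → E} {X₂ : ∀ i, Ω₂ i → E} {Z : Ω' → E}
    (h : TendstoInDistribution X₁ l Z P₁ P') (hX : ∀ i, AEMeasurable (X₂ i) (P₂ i))
    (hmap : ∀ i, (P₂ i).map (X₂ i) = (P₁ i).map (X₁ i)) :
    TendstoInDistribution X₂ l Z P₂ P' := by
  refine ⟨hX, h.aemeasurable_limit, ?_⟩
  exact h.tendsto.congr fun i => Subtype.ext (hmap i).symm

section Iid

variable {μ : Measure ℝ} [IsProbabilityMeasure μ] {Ω : Type*} [MeasurableSpace Ω] {P : Measure Ω}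
  [IsProbabilityMeasure P] {Y : ℕ → Ω → ℝ}

/-- The logarithm of the ratio of two sample quantiles is asymptotically linear. -/
theorem tendstoInMeasure_logRatioStat_sub (hlaw : ∀ i, HasLaw (Y i) μ P) (hindep : iIndepFun Y P)
    {s : ℕ} (hs : 1 ≤ s) {x y d e : ℝ} (hx0 : x ≠ 0) (hy0 : y ≠ 0) (hd : 0 < d) (he : 0 < e)
    (hFx : HasDerivAt (fun t => cdf μ t) d x) (hFy : HasDerivAt (fun t => cdf μ t) e y)
    (hpx : cdf μ x = 1 / ((s : ℝ) + 1)) (hpy : cdf μ y = (s : ℝ) / ((s : ℝ) + 1)) :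
    TendstoInMeasure P ((fun (k : ℕ) ω => logRatioStat s k x y fun i => Y i ω) -
      fun (k : ℕ) ω => normalizedSum μ Y
        (fun z => (x * d)⁻¹ * iicInd x z - (y * e)⁻¹ * iicInd y z) ((s + 1) * k - 1) ω)
      atTop 0 := by
  set N : ℕ → ℕ := fun k => (s + 1) * k - 1 with hNdef
  have hN : Tendsto N atTop atTop := by
    refine tendsto_atTop_mono (fun k => ?_) (tendsto_sub_atTop_nat 1)
    exact Nat.sub_le_sub_right (Nat.le_mul_of_pos_left k (by omega)) 1
  have hsq : Tendsto (fun k => √(N k : ℝ)) atTop atTop :=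
    Real.tendsto_sqrt_atTop.comp (tendsto_natCast_atTop_atTop.comp hN)
  have hNcast : ∀ k, 1 ≤ k → (N k : ℝ) = ((s : ℝ) + 1) * k - 1 := fun k hk => by
    rw [hNdef, Nat.cast_sub (Nat.mul_pos (by omega) hk)]
    push_cast
    ring
  have hs1 : (s : ℝ) + 1 ≠ 0 := by positivity
  have hmul : ∀ k, 1 ≤ k → k ≤ s * k := fun k _ => Nat.le_mul_of_pos_left k hs
  have hjx : ∀ᶠ k in atTop, 1 ≤ k ∧ k ≤ N k := by
    filter_upwards [eventually_ge_atTop 1] with k hk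
    have := hmul k hk
    simp only [hNdef, add_mul, one_mul]
    omega
  have hjy : ∀ᶠ k in atTop, 1 ≤ k * s ∧ k * s ≤ N k := by
    filter_upwards [eventually_ge_atTop 1] with k hk
    have := hmul k hk
    simp only [hNdef, add_mul, one_mul, mul_comm k s]
    omega
  -- Since `N = (s + 1) k - 1`, the rank differs from `N F(x)` by exactly `1 / (s + 1)`; for `y` the
  -- gap is `s / (s + 1)`.
  have hrx : Tendsto (fun k : ℕ => ((k : ℝ) - N k * cdf μ x) / √(N k : ℝ)) atTop (𝓝 0) := by
    refine ((tendsto_const_nhds (x := 1 / ((s : ℝ) + 1))).div_atTop hsq).congr' ?_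
    filter_upwards [eventually_ge_atTop 1] with k hk
    rw [hNcast k hk, hpx]
    congr 1
    field_simp
    ring
  have hry : Tendsto (fun k : ℕ => (((k * s : ℕ) : ℝ) - N k * cdf μ y) / √(N k : ℝ))
      atTop (𝓝 0) := by
    refine ((tendsto_const_nhds (x := (s : ℝ) / ((s : ℝ) + 1))).div_atTop hsq).congr' ?_
    filter_upwards [eventually_ge_atTop 1] with k hk
    rw [hNcast k hk, hpy]
    congr 1
    push_cast
    field_simp
    ring
  set A : ℕ → Ω → ℝ := fun k ω => orderStat (fun m : Fin (N k) => Y m ω) k with hA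
  set B : ℕ → Ω → ℝ := fun k ω => orderStat (fun m : Fin (N k) => Y m ω) (k * s) with hB
  have repx := tendstoInMeasure_orderStat_sub_normalizedSum hlaw hindep hN hjx hd hFx hrx
  have repy := tendstoInMeasure_orderStat_sub_normalizedSum hlaw hindep hN hjy he hFy hry
  have bd : ∀ (c t : ℝ), BoundedInProb P
      (fun k ω => c * normalizedSum μ Y (iicInd t) (N k) ω) atTop := fun c t => by
    have h := boundedInProb_normalizedSum (l := atTop) hlaw hindep
      ((measurable_iicInd t).const_mul c) ((memLp_iicInd t 2).const_mul c) N
    have e := fun n ω => normalizedSum_comb (Y := Y) (integrable_iicInd (μ := μ) t)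
      (integrable_iicInd (μ := μ) t) c 0 n ω
    simp only [zero_mul, sub_zero] at e
    simpa only [e] using h
  have bdx := (bd _ _).of_tendstoInMeasure_sub repx
  have bdy := (bd _ _).of_tendstoInMeasure_sub repy
  -- `Real.log` is `log |·|`, with derivative `x⁻¹` at every `x ≠ 0`, so negative quantiles need no
  -- separate case.
  have dx := bdx.delta_method hsq (Real.hasDerivAt_log hx0)
  have dy := bdy.delta_method hsq (Real.hasDerivAt_log hy0)
  have hlin : TendstoInMeasure P (fun k ω => √(N k : ℝ) * (Real.log (B k ω) - Real.log (A k ω) -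
      (Real.log y - Real.log x)) - normalizedSum μ Y
        (fun z => (x * d)⁻¹ * iicInd x z - (y * e)⁻¹ * iicInd y z) (N k) ω) atTop 0 := by
    have h := TendstoInMeasure.add_zero_zero
      (TendstoInMeasure.add_zero_zero dy (TendstoInMeasure.const_mul_zero dx (-1)))
      (TendstoInMeasure.add_zero_zero (TendstoInMeasure.const_mul_zero repy y⁻¹)
        (TendstoInMeasure.const_mul_zero repx (-x⁻¹)))
    convert! h using 3 with k ω
    rw [normalizedSum_comb (integrable_iicInd x) (integrable_iicInd y), mul_inv, mul_inv]
    simp only [hA, hB]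
    ring
  rw [tendstoInMeasure_zero_iff] at hlin ⊢
  intro ε hε
  -- The log of the ratio splits unless an order statistic vanishes. A zero lies at distance `|x|`
  -- or `|y|` from the limit, so this has vanishing probability.
  have hnz : Tendsto (fun k => P ({ω | |x| ≤ |A k ω - x|} ∪ {ω | |y| ≤ |B k ω - y|}))
      atTop (𝓝 0) :=
    tendsto_measure_zero_of_subset_union (Eventually.of_forall fun _ => subset_rfl)
      (bdx.tendsto_measure_ge hsq (abs_pos.2 hx0)) (bdy.tendsto_measure_ge hsq (abs_pos.2 hy0))
  refine tendsto_measure_zero_of_subset_union (Eventually.of_forall fun k ω hω => ?_)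
    (hlin ε hε) hnz
  by_cases hzero : A k ω = 0 ∨ B k ω = 0
  · right
    rcases hzero with h | h
    · left; simp [h]
    · right; simp [h]
  · left
    rw [not_or] at hzero
    simp only [Set.mem_ofPred_eq, Pi.sub_apply, logRatioStat] at hω ⊢
    change ε ≤ |√(N k : ℝ) * (Real.log (B k ω / A k ω) - Real.log (y / x)) - _| at hω
    rwa [Real.log_div hzero.2 hzero.1, Real.log_div hy0 hx0] at hω

theorem tendstoInDistribution_logRatioStat (hY : ∀ i, HasLaw (Y i) μ P)
    (hindep : iIndepFun Y P)
    {s : ℕ} (hs : 2 ≤ s) {x y d e : ℝ} (hx0 : x ≠ 0) (hy0 : y ≠ 0) (hd : 0 < d) (he : 0 < e)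
    (hFx : HasDerivAt (fun t => cdf μ t) d x) (hFy : HasDerivAt (fun t => cdf μ t) e y)
    (hpx : cdf μ x = 1 / ((s : ℝ) + 1)) (hpy : cdf μ y = (s : ℝ) / ((s : ℝ) + 1)) :
    TendstoInDistribution (fun (k : ℕ) ω => logRatioStat s k x y fun i => Y i ω) atTop
      (id : ℝ → ℝ) (fun _ => P)
      (gaussianReal 0 (asympVariance s (x * d) (y * e)).toNNReal) := by
  have hs' : (2 : ℝ) ≤ s := by exact_mod_cast hs
  -- The covariance formula needs the levels ordered; `1 / (s + 1) < s / (s + 1)` forces it.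
  have hxy : x ≤ y := by
    by_contra! h
    have := monotone_cdf μ h.le
    rw [hpx, hpy] at this
    have h2 : (1 : ℝ) / ((s : ℝ) + 1) < s / (s + 1) := by gcongr; linarith
    linarith
  have hN : Tendsto (fun k => (s + 1) * k - 1) atTop atTop := by
    refine tendsto_atTop_mono (fun k => ?_) (tendsto_sub_atTop_nat 1)
    exact Nat.sub_le_sub_right (Nat.le_mul_of_pos_left k (by omega)) 1
  have hm : Measurable fun z => (x * d)⁻¹ * iicInd x z - (y * e)⁻¹ * iicInd y z :=
    ((measurable_iicInd x).const_mul _).sub ((measurable_iicInd y).const_mul _)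
  have hL : MemLp (fun z => (x * d)⁻¹ * iicInd x z - (y * e)⁻¹ * iicInd y z) 2 μ :=
    ((memLp_iicInd x 2).const_mul _).sub ((memLp_iicInd y 2).const_mul _)
  have hvar : Var[fun z => (x * d)⁻¹ * iicInd x z - (y * e)⁻¹ * iicInd y z; μ] =
      asympVariance s (x * d) (y * e) := by
    rw [variance_iicInd_comb hxy, hpx, hpy, asympVariance]
    have : (s : ℝ) + 1 ≠ 0 := by positivity
    field_simp
    ring
  have hclt := tendstoInDistribution_normalizedSum hY hindep hm hL hN
  rw [hvar] at hclt
  refine tendstoInDistribution_of_tendstoInMeasure_sub _ _ hclt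
    (tendstoInMeasure_logRatioStat_sub hY hindep (by omega) hx0 hy0 hd he hFx hFy hpx hpy)
    fun k => ?_
  exact (measurable_logRatioStat s k x y).comp_aemeasurable
    (aemeasurable_pi_lambda _ fun i => (hY i).aemeasurable)

end Iid

theorem theorem1
    (s : ℕ) (hs : 2 ≤ s)
    -- the law `μ` of the observed variable, with c.d.f. `F = cdf μ`
    (μ : Measure ℝ) [IsProbabilityMeasure μ]
    -- for every `k`, a sample of `n = (s + 1) k - 1` independent observations
    {Ω : ℕ → Type*} [∀ k, MeasurableSpace (Ω k)]
    (P : ∀ k, Measure (Ω k)) [∀ k, IsProbabilityMeasure (P k)]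
    (X : ∀ k, Fin ((s + 1) * k - 1) → Ω k → ℝ)
    (hlaw : ∀ k i, HasLaw (X k i) μ (P k))
    (hindep : ∀ k, iIndepFun (X k) (P k))
    -- the two theoretical quantiles, whose ratio has to have a logarithm
    (x y : ℝ)
    (hx : x = quantile μ (1 / ((s : ℝ) + 1)))
    (hy : y = quantile μ ((s : ℝ) / ((s : ℝ) + 1)))
    (hxy : 0 < y / x)
    -- `f = F'` exists at the two quantiles, and it is positive and finite there
    (f : ℝ → ℝ)
    (hfx : HasDerivAt (fun t => cdf μ t) (f x) x) (hfx_pos : 0 < f x)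
    (hfy : HasDerivAt (fun t => cdf μ t) (f y) y) (hfy_pos : 0 < f y)
    (a b : ℝ) (ha : a = x * f x) (hb : b = y * f y) :
    0 < asympVariance s a b ∧
    TendstoInDistribution
      (fun (k : ℕ) (ω : Ω k) => logRatioStat s k x y (fun i => X k i ω))
      atTop (id : ℝ → ℝ) P (gaussianReal 0 (asympVariance s a b).toNNReal) ∧
    HasDerivAt (fun p => Real.log (quantile μ p)) (1 / a) (1 / ((s : ℝ) + 1)) ∧
    HasDerivAt (fun p => Real.log (quantile μ p)) (1 / b) ((s : ℝ) / ((s : ℝ) + 1)) := by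
  have hs' : (2 : ℝ) ≤ s := by exact_mod_cast hs
  have hx0 : x ≠ 0 := by rintro rfl; simp at hxy
  have hy0 : y ≠ 0 := by rintro rfl; simp at hxy
  have hp0 : 0 < 1 / ((s : ℝ) + 1) := by positivity
  have hp1 : 1 / ((s : ℝ) + 1) < 1 := by rw [div_lt_one (by positivity)]; linarith
  have hq0 : 0 < (s : ℝ) / ((s : ℝ) + 1) := by positivity
  have hq1 : (s : ℝ) / ((s : ℝ) + 1) < 1 := by rw [div_lt_one (by positivity)]; linarith
  have hlog : ∀ {p t d : ℝ}, 0 < p → p < 1 → t = quantile μ p → t ≠ 0 → 0 < d →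
      HasDerivAt (fun t => cdf μ t) d t →
      HasDerivAt (fun p => Real.log (quantile μ p)) (1 / (t * d)) p := by
    intro p t d h0 h1 ht ht0 hd hF
    subst ht
    have h := (hasDerivAt_quantile μ h0 h1 hd hF).log ht0
    convert! h using 1
    field_simp
  have hpx : cdf μ x = 1 / ((s : ℝ) + 1) := by
    have := cdf_quantile μ hp0 hp1 (by rw [← hx]; exact hfx.continuousAt)
    rwa [← hx] at this
  have hpy : cdf μ y = (s : ℝ) / ((s : ℝ) + 1) := by
    have := cdf_quantile μ hq0 hq1 (by rw [← hy]; exact hfy.continuousAt)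
    rwa [← hy] at this
  subst ha hb
  refine ⟨asympVariance_pos hs (mul_ne_zero hx0 hfx_pos.ne'), ?_,
    hlog hp0 hp1 hx hx0 hfx_pos hfx, hlog hq0 hq1 hy hy0 hfy_pos hfy⟩
  -- The samples for different `k` may live on unrelated spaces. Each has the joint law of an
  -- initial segment of one i.i.d. sequence, and convergence in distribution sees only laws.
  obtain ⟨Ω', _, P', Y, -, hY, hYindep, _⟩ := exists_iid ℕ μ
  have hstat : ∀ k, Measurable (logRatioStat s k x y) := fun k => measurable_logRatioStat s k x y
  have hXm : ∀ k, AEMeasurable (fun ω i => X k i ω) (P k) := fun k =>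
    aemeasurable_pi_lambda _ fun i => (hlaw k i).aemeasurable
  refine TendstoInDistribution.of_map_eq (tendstoInDistribution_logRatioStat hY hYindep hs hx0 hy0
    hfx_pos hfy_pos hfx hfy hpx hpy) (fun k => (hstat k).comp_aemeasurable (hXm k)) fun k => ?_
  have hYm : AEMeasurable (fun ω (i : Fin ((s + 1) * k - 1)) => Y i ω) P' :=
    aemeasurable_pi_lambda _ fun i => (hY i).aemeasurable
  have hjoint : (P k).map (fun ω i => X k i ω) =
      P'.map fun ω (i : Fin ((s + 1) * k - 1)) => Y i ω := by
    rw [(iIndepFun_iff_map_fun_eq_pi_map fun i => (hlaw k i).aemeasurable).1 (hindep k),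
      (iIndepFun_iff_map_fun_eq_pi_map (f := fun (i : Fin ((s + 1) * k - 1)) => Y i)
        fun i => (hY i).aemeasurable).1 (hYindep.precomp Fin.val_injective)]
    simp only [(hlaw k _).map_eq, (hY _).map_eq]
  have h1 := AEMeasurable.map_map_of_aemeasurable (hstat k).aemeasurable (hXm k)
  have h2 := AEMeasurable.map_map_of_aemeasurable (hstat k).aemeasurable hYm
  rw [hjoint] at h1
  exact h1.symm.trans h2
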